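/- Let $(X,\mathcal B,\mu)$ be a standard Borel space with a $\sigma$-finite measure $\mu$ satisfying $\mu(\{x\})=0$ for all $x\in X$. Let $X^*$ be the set of countable subsets of $X$, with the $\sigma$-algebra $\mathcal B^*$ generated by the sets $\{\omega : |\omega\cap B|=n\}$ ($B\in\mathcal B$, $n\ge 0$), and let $\mu^*$ be the law on $(X^*,\mathcal B^*)$ of the Poisson point process with intensity $\mu$: for pairwise disjoint $A_1,\dots,A_n\in\mathcal B$ the counts $|\omega\cap A_i|$ are independent, and $|\omega\cap A|$ is Poisson distributed with mean $\mu(A)$ for every $A\in\mathcal B$ (almost surely infinite if $\mu(A)=\infty$). Let $T=(T_g)_{g\in G}$ be an action of a group $G$ on $X$ by measurable, $\mu$-preserving transformations, and let $T_*$ be the induced action on $X^*$, $(T_g)_*(\omega)=\{T_g x : x\in\omega\}$. Assume that the product action $T\times T_*$ on $(X\times X^*,\ \mathcal B\otimes\mathcal B^*,\ \mu\times\mu^*)$ is ergodic: every measurable set that is invariant modulo null sets under each $T_g\times (T_g)_*$ is null or has null complement. A (deterministic) thinning is a measurable map $\Psi:X^*\to X^*$ such that for every $B\in\mathcal B$,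 $|\Psi(\omega)\cap B|\le|\omega\cap B|$ for $\mu^*$-almost every $\omega$. It is $T$-equivariant if for every $g\in G$, $\Psi\circ (T_g)_*=(T_g)_*\circ\Psi$ holds $\mu^*$-almost everywhere. Then every $T$-equivariant thinning $\Psi$ is trivial: either $\Psi(\omega)=\emptyset$ for $\mu^*$-almost every $\omega$, or $\Psi(\omega)=\omega$ for $\mu^*$-almost every $\omega$. -/

import Mathlib

open MeasureTheory ProbabilityTheory

/-- The space `X*` of countable subsets of `X`. -/
def CountableConfig (X : Type*) : Type _ := {s : Set X // s.Countable}

namespace CountableConfig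

variable {X : Type*}

/-- The underlying set of points of a configuration. -/
def points (ω : CountableConfig X) : Set X := ω.1

/-- The number `|ω ∩ B|` of points of `ω` in `B`, possibly infinite. -/
noncomputable def count (B : Set X) (ω : CountableConfig X) : ℕ∞ := (ω.points ∩ B).encard

/-- The configuration without points. -/
def empty : CountableConfig X := ⟨∅, Set.countable_empty⟩

/-- The σ-algebra on `X*` generated by the events `|ω ∩ B| = n`, for `B` measurable and `n : ℕ`. -/
instance [MeasurableSpace X] : MeasurableSpace (CountableConfig X) :=
  MeasurableSpace.generateFrom
    {S | ∃ B : Set X, MeasurableSet B ∧ ∃ n : ℕ, S = {ω | count B ω = n}}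

/-- An action `T` on `X` induces the action `T_*` on `X*` given by `T_*(ω) = {T x : x ∈ ω}`. -/
instance {G : Type*} [Group G] [MulAction G X] : MulAction G (CountableConfig X) where
  smul g ω := ⟨(fun x => g • x) '' ω.1, ω.2.image _⟩
  one_smul ω := Subtype.ext (by
    change (fun x => (1 : G) • x) '' ω.1 = ω.1
    simp)
  mul_smul g h ω := Subtype.ext (by
    change (fun x => (g * h) • x) '' ω.1 = (fun x => g • x) '' ((fun x => h • x) '' ω.1)
    simp [Set.image_image, mul_smul])

end CountableConfig

/-- `P` is the law of the Poisson point process with intensity `μ`: the numbers of points in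
pairwise disjoint measurable sets are jointly independent, and the number of points in `A` has the
Poisson distribution with mean `μ A` (and is almost surely infinite if `μ A = ∞`). -/
structure IsPoissonProcess {X : Type*} [MeasurableSpace X] (μ : Measure X)
    (P : Measure (CountableConfig X)) : Prop where
  isProbabilityMeasure : IsProbabilityMeasure P
  indep : ∀ (n : ℕ) (A : Fin n → Set X), (∀ i, MeasurableSet (A i)) →
    Pairwise (fun i j => Disjoint (A i) (A j)) →
    iIndepFun (fun i => CountableConfig.count (A i)) P
  law : ∀ A : Set X, MeasurableSet A → μ A ≠ ⊤ → ∀ k : ℕ,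
    P {ω | CountableConfig.count A ω = k} =
      ENNReal.ofReal (Real.exp (-(μ A).toReal) * (μ A).toReal ^ k / (k.factorial : ℝ))
  law_top : ∀ A : Set X, MeasurableSet A → μ A = ⊤ → ∀ k : ℕ,
    P {ω | CountableConfig.count A ω = k} = 0

/-- A deterministic thinning of the point process with law `P`. -/
structure IsThinning {X : Type*} [MeasurableSpace X] (P : Measure (CountableConfig X))
    (Ψ : CountableConfig X → CountableConfig X) : Prop where
  measurable : Measurable Ψ
  count_le : ∀ B : Set X, MeasurableSet B →
    ∀ᵐ ω ∂P, CountableConfig.count B (Ψ ω) ≤ CountableConfig.count B ω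

/-- `Ψ ∘ T_* = T_* ∘ Ψ` almost surely, for each transformation of the action. -/
def IsEquivariantThinning (G : Type*) {X : Type*} [Group G] [MulAction G X] [MeasurableSpace X]
    (P : Measure (CountableConfig X)) (Ψ : CountableConfig X → CountableConfig X) : Prop :=
  IsThinning P Ψ ∧ ∀ g : G, ∀ᵐ ω ∂P, Ψ (g • ω) = g • Ψ ω

/-- A thinning is trivial if almost surely it deletes every point, or almost surely it deletes
none. -/
def IsTrivialThinning {X : Type*} [MeasurableSpace X]
    (P : Measure (CountableConfig X)) (Ψ : CountableConfig X → CountableConfig X) : Prop :=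
  (∀ᵐ ω ∂P, Ψ ω = CountableConfig.empty) ∨ (∀ᵐ ω ∂P, Ψ ω = ω)

/-!
By Mecke's formula, adding to the Poisson process an independent point `x` chosen according to `μ`
yields the same as selecting a point of the process, up to a change of density. The set of pairs
`(x, ω)` such that `Ψ` retains `x` in `ω ∪ {x}` is invariant under `T × T_*` because `Ψ` is
equivariant; by ergodicity it is null or conull, and Mecke's formula turns this into a statement on
all points of `ω` at once: almost surely `Ψ` deletes all of them, or retains all of them.

Mecke's formula for events of the configuration is verified on the void events `{ω ∩ B = ∅}` only
(Rényi): they form a π-system, and they generate the σ-algebra of `X*` because `|ω ∩ B|` is the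
supremum, over increasingly fine finite partitions separating the points of `X`, of the number of
cells that `ω ∩ B` meets.
-/

open Filter
open scoped ENNReal

section Separation

variable {X Y : Type*} {f : X → ℕ → Y}

theorem exists_injOn_initialSegment (hf : Function.Injective f) {F : Set X} (hF : F.Finite) :
    ∃ n, Set.InjOn (fun x (i : Fin n) => f x i) F := by
  have hsep : ∀ p ∈ F.offDiag, ∀ᶠ n in atTop, ∃ i < n, f p.1 i ≠ f p.2 i := by
    rintro ⟨x, y⟩ ⟨-, -, hxy⟩
    obtain ⟨i, hi⟩ := Function.ne_iff.1 (hf.ne hxy)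
    exact (eventually_gt_atTop i).mono fun n hn => ⟨i, hn, hi⟩
  obtain ⟨n, hn⟩ := ((eventually_all_finite hF.offDiag).2 hsep).exists
  refine ⟨n, fun x hx y hy heq => by_contra fun hxy => ?_⟩
  obtain ⟨i, hi, hne⟩ := hn (x, y) ⟨hx, hy, hxy⟩
  exact hne (congrFun heq ⟨i, hi⟩)

theorem natCast_le_encard_iff_exists_initialSegment (hf : Function.Injective f) {s : Set X}
    {k : ℕ} : (k : ℕ∞) ≤ s.encard ↔ ∃ n, k ≤ ((fun x (i : Fin n) => f x i) '' s).encard := by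
  constructor
  · intro hk
    obtain ⟨F, hFs, hF⟩ := Set.exists_subset_encard_eq hk
    obtain ⟨n, hn⟩ := exists_injOn_initialSegment hf (Set.finite_of_encard_eq_coe hF)
    exact ⟨n, by rw [← hF, ← hn.encard_image]; exact Set.encard_le_encard (Set.image_mono hFs)⟩
  · rintro ⟨n, hn⟩
    exact hn.trans (Set.encard_image_le _ s)

end Separation

theorem lintegral_natCast_poissonMeasure (r : NNReal) :
    ∫⁻ n, (n : ℝ≥0∞) ∂poissonMeasure r = r := by
  have hrec : ∀ n : ℕ, ((n + 1 : ℕ) : ℝ≥0∞) * poissonMeasure r {n + 1} =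
      r * poissonMeasure r {n} := fun n => by
    rw [poissonMeasure_singleton, poissonMeasure_singleton, ← ENNReal.ofReal_natCast,
      ← ENNReal.ofReal_coe_nnreal, ← ENNReal.ofReal_mul (by positivity),
      ← ENNReal.ofReal_mul (by positivity), Nat.factorial_succ]
    congr 1
    push_cast
    field_simp
    ring
  have htotal : ∑' n, poissonMeasure r {n} = 1 := by
    simpa using (lintegral_countable' (μ := poissonMeasure r) 1).symm
  rw [lintegral_countable', tsum_eq_zero_add' ENNReal.summable]
  simp only [Nat.cast_zero, zero_mul, zero_add, hrec]
  rw [ENNReal.tsum_mul_left, htotal, mul_one]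

namespace CountableConfig

section Points

variable {X : Type*} {A B : Set X} {ω : CountableConfig X}

/-- The void event of `B`: the configurations with no point in `B`. -/
def avoiding (B : Set X) : Set (CountableConfig X) := {ω | Disjoint ω.points B}

theorem count_preimage_zero (B : Set X) : count B ⁻¹' {0} = avoiding B := by
  ext ω
  rw [Set.mem_preimage, Set.mem_singleton_iff, count, Set.encard_eq_zero,
    ← Set.disjoint_iff_inter_eq_empty]
  rfl

theorem avoiding_empty : avoiding (∅ : Set X) = Set.univ :=
  Set.eq_univ_of_forall fun _ => Set.disjoint_empty _

theorem avoiding_union (A B : Set X) : avoiding (A ∪ B) = avoiding A ∩ avoiding B :=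
  Set.ext fun _ => Set.disjoint_union_right

theorem count_diff_of_mem_avoiding (hω : ω ∈ avoiding A) (B : Set X) :
    count (B \ A) ω = count B ω := by
  rw [count, count, Set.inter_sdiff_distrib_left, sdiff_eq_left.2]
  exact Set.disjoint_of_subset Set.inter_subset_left Set.inter_subset_right hω

theorem ext_points {ω ω' : CountableConfig X} (h : ω.points = ω'.points) : ω = ω' :=
  Subtype.ext h

/-- The configuration `ω` with the point `x` added; it is `ω` itself if `x` is already there. -/
def insertPoint (x : X) (ω : CountableConfig X) : CountableConfig X :=
  ⟨insert x ω.points, ω.2.insert x⟩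

theorem insertPoint_mem_avoiding {x : X} :
    insertPoint x ω ∈ avoiding B ↔ x ∉ B ∧ ω ∈ avoiding B :=
  Set.disjoint_insert_left

variable {G : Type*} [Group G] [MulAction G X]

theorem smul_mem_points_smul {g : G} {x : X} : g • x ∈ (g • ω).points ↔ x ∈ ω.points :=
  (MulAction.injective g).mem_set_image

theorem smul_insertPoint (g : G) (x : X) (ω : CountableConfig X) :
    g • insertPoint x ω = insertPoint (g • x) (g • ω) :=
  ext_points Set.image_insert_eq

end Points

section VoidEvents

variable {X : Type*} [MeasurableSpace X]

theorem measurable_count {B : Set X} (hB : MeasurableSet B) : Measurable (count B) :=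
  ENat.measurable_iff.2 fun n => MeasurableSpace.measurableSet_generateFrom ⟨B, hB, n, rfl⟩

theorem measurable_toENNReal_count {B : Set X} (hB : MeasurableSet B) :
    Measurable fun ω => (count B ω : ℝ≥0∞) :=
  (Measurable.of_discrete (f := ENat.toENNReal)).comp (measurable_count hB)

theorem measurableSet_avoiding {B : Set X} (hB : MeasurableSet B) : MeasurableSet (avoiding B) :=
  count_preimage_zero B ▸ measurable_count hB (measurableSet_singleton 0)

variable (X) in
/-- The void events of the measurable sets. -/
def voidEvents : Set (Set (CountableConfig X)) := avoiding '' {B | MeasurableSet B}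

theorem isPiSystem_voidEvents : IsPiSystem (voidEvents X) := by
  rintro _ ⟨A, hA, rfl⟩ _ ⟨B, hB, rfl⟩ -
  exact ⟨A ∪ B, hA.union hB, avoiding_union A B⟩

theorem measurable_encard_image_of_measurableSet_avoiding {m : MeasurableSpace (CountableConfig X)}
    (hm : ∀ B : Set X, MeasurableSet B → MeasurableSet[m] (avoiding B)) {C : Type*} [Countable C]
    {φ : X → C} (hφ : ∀ c, MeasurableSet (φ ⁻¹' {c})) {B : Set X} (hB : MeasurableSet B) :
    Measurable[m] fun ω : CountableConfig X => (φ '' (ω.points ∩ B)).encard := by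
  refine measurable_encard.comp (measurable_set_iff.2 fun c => ?_)
  have hhit : {ω : CountableConfig X | c ∈ φ '' (ω.points ∩ B)} = (avoiding (B ∩ φ ⁻¹' {c}))ᶜ := by
    ext ω
    simp only [avoiding, Set.mem_image, Set.mem_compl_iff, Set.mem_ofPred_eq, Set.not_disjoint_iff,
      Set.mem_inter_iff, Set.mem_preimage, Set.mem_singleton_iff, and_assoc]
  exact measurableSet_setOfPred.1 (hhit ▸ (hm _ (hB.inter (hφ c))).compl)

theorem measurable_count_of_measurableSet_avoiding [MeasurableSpace.CountablySeparated X]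
    {m : MeasurableSpace (CountableConfig X)}
    (hm : ∀ B : Set X, MeasurableSet B → MeasurableSet[m] (avoiding B)) {B : Set X}
    (hB : MeasurableSet B) : Measurable[m] (count B) := by
  obtain ⟨f, hfm, hf⟩ := MeasurableSpace.measurable_injection_nat_bool_of_countablySeparated X
  have hle : ∀ k : ℕ, MeasurableSet[m] {ω | k ≤ count B ω} := fun k => by
    simp only [count, natCast_le_encard_iff_exists_initialSegment hf, Set.ofPred_exists]
    refine MeasurableSet.iUnion fun n => ?_
    have hφ : Measurable fun x (i : Fin n) => f x i := by fun_prop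
    exact measurable_encard_image_of_measurableSet_avoiding hm
      (fun c => hφ (measurableSet_singleton c)) hB (.of_discrete (s := Set.Ici (k : ℕ∞)))
  refine ENat.measurable_iff.2 fun n => ?_
  have hdiff : count B ⁻¹' {(n : ℕ∞)} =
      {ω | (n : ℕ∞) ≤ count B ω} \ {ω | ((n + 1 : ℕ) : ℕ∞) ≤ count B ω} := by
    ext ω
    rw [Set.mem_preimage, Set.mem_singleton_iff, Set.mem_sdiff, Set.mem_ofPred_eq,
      Set.mem_ofPred_eq, Nat.cast_add_one, ENat.add_one_le_iff (ENat.natCast_ne_top n), not_lt,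
      le_antisymm_iff, and_comm]
  exact hdiff ▸ (hle n).diff (hle (n + 1))

theorem generateFrom_voidEvents [MeasurableSpace.CountablySeparated X] :
    (inferInstance : MeasurableSpace (CountableConfig X)) =
      MeasurableSpace.generateFrom (voidEvents X) := by
  refine le_antisymm (MeasurableSpace.generateFrom_le ?_) (MeasurableSpace.generateFrom_le ?_)
  · rintro _ ⟨B, hB, n, rfl⟩
    refine measurable_count_of_measurableSet_avoiding (fun A hA => ?_) hB
      (measurableSet_singleton (n : ℕ∞))
    exact MeasurableSpace.measurableSet_generateFrom ⟨A, hA, rfl⟩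
  · rintro _ ⟨B, hB, rfl⟩
    exact measurableSet_avoiding hB

theorem ext_of_avoiding [MeasurableSpace.CountablySeparated X]
    {P Q : Measure (CountableConfig X)} [IsFiniteMeasure P]
    (h : ∀ B : Set X, MeasurableSet B → P (avoiding B) = Q (avoiding B)) : P = Q := by
  refine ext_of_generate_finite _ generateFrom_voidEvents isPiSystem_voidEvents ?_ ?_
  · rintro _ ⟨B, hB, rfl⟩
    exact h B hB
  · simpa only [avoiding_empty] using h ∅ .empty

theorem measurable_of_measurableSet_preimage_avoiding [MeasurableSpace.CountablySeparated X]
    {Y : Type*} [MeasurableSpace Y] {f : Y → CountableConfig X}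
    (hf : ∀ B : Set X, MeasurableSet B → MeasurableSet (f ⁻¹' avoiding B)) : Measurable f :=
  measurable_iff_le_map.2 <| generateFrom_voidEvents.trans_le <|
    MeasurableSpace.generateFrom_le <| by
      rintro _ ⟨B, hB, rfl⟩
      exact hf B hB

theorem measurable_insertPoint [MeasurableSpace.CountablySeparated X] :
    Measurable fun p : X × CountableConfig X => insertPoint p.1 p.2 := by
  refine measurable_of_measurableSet_preimage_avoiding fun B hB => ?_
  have hpre : (fun p : X × CountableConfig X => insertPoint p.1 p.2) ⁻¹' avoiding B =
      Bᶜ ×ˢ avoiding B := Set.ext fun _ => insertPoint_mem_avoiding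
  exact hpre ▸ hB.compl.prod (measurableSet_avoiding hB)

end VoidEvents

end CountableConfig

namespace CountableConfig

variable {X : Type*} [MeasurableSpace X] {S : ℕ → Set X}

/-- The configurations with finitely many points in each of the sets `S k`, which are meant to
exhaust the space. -/
def locallyFinite (S : ℕ → Set X) : Set (CountableConfig X) := {ω | ∀ k, count (S k) ω ≠ ⊤}

theorem measurableSet_locallyFinite (hS : ∀ k, MeasurableSet (S k)) :
    MeasurableSet (locallyFinite S) := by
  simp only [locallyFinite, Set.ofPred_forall]
  exact .iInter fun k => measurable_count (hS k) (measurableSet_singleton ⊤).compl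

omit [MeasurableSpace X] in
theorem locallyFinite_of_points_subset {ω ω' : CountableConfig X} (h : ω'.points ⊆ ω.points)
    (hω : ω ∈ locallyFinite S) : ω' ∈ locallyFinite S := fun k =>
  ne_top_of_le_ne_top (hω k) (Set.encard_le_encard (Set.inter_subset_inter_left _ h))

theorem exists_countable_separating_points [MeasurableSpace.CountablySeparated X]
    (hS : ∀ k, MeasurableSet (S k)) (hcover : ⋃ k, S k = Set.univ) :
    ∃ 𝒲 : Set (Set X), 𝒲.Countable ∧ (∀ W ∈ 𝒲, MeasurableSet W) ∧
      ∀ ω ∈ locallyFinite S, ∀ x ∉ ω.points, ∃ W ∈ 𝒲, x ∈ W ∧ ω ∈ avoiding W := by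
  obtain ⟨f, hfm, hf⟩ := MeasurableSpace.measurable_injection_nat_bool_of_countablySeparated X
  let cell (k n : ℕ) (c : Fin n → Bool) : Set X := S k ∩ (fun x (i : Fin n) => f x i) ⁻¹' {c}
  refine ⟨⋃ k, ⋃ n, Set.range (cell k n), ?_, ?_, ?_⟩
  · exact Set.countable_iUnion fun k => Set.countable_iUnion fun n => Set.countable_range _
  · simp only [Set.mem_iUnion]
    rintro _ ⟨k, n, c, rfl⟩
    have hinit : Measurable fun x (i : Fin n) => f x i := by fun_prop
    exact (hS k).inter (hinit (measurableSet_singleton c))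
  · intro ω hω x hx
    obtain ⟨k, hk⟩ := Set.iUnion_eq_univ_iff.1 hcover x
    obtain ⟨n, hn⟩ := exists_injOn_initialSegment hf
      ((Set.encard_ne_top_iff.1 (hω k)).insert x)
    refine ⟨cell k n fun i => f x i, Set.mem_iUnion₂.2 ⟨k, n, _, rfl⟩, ⟨hk, rfl⟩, ?_⟩
    refine Set.disjoint_left.2 fun y hy ⟨hyk, hyx⟩ => hx ?_
    exact hn (Set.mem_insert_of_mem x ⟨hy, hyk⟩) (Set.mem_insert x _) hyx ▸ hy

theorem measurableSet_setOf_mem_points [MeasurableSpace.CountablySeparated X]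
    (hS : ∀ k, MeasurableSet (S k)) (hcover : ⋃ k, S k = Set.univ) :
    MeasurableSet {p : X × CountableConfig X | p.1 ∈ p.2.points ∧ p.2 ∈ locallyFinite S} := by
  obtain ⟨𝒲, h𝒲, hmeas, hsep⟩ := exists_countable_separating_points hS hcover
  have hcompl : {p : X × CountableConfig X | p.1 ∈ p.2.points ∧ p.2 ∈ locallyFinite S} =
      Prod.snd ⁻¹' locallyFinite S \ ⋃ W ∈ 𝒲, W ×ˢ avoiding W := by
    ext ⟨x, ω⟩
    simp only [Set.mem_ofPred_eq, Set.mem_sdiff, Set.mem_preimage, Set.mem_iUnion₂, Set.mem_prod,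
      exists_prop, and_comm (a := x ∈ ω.points), and_congr_right_iff]
    refine fun hω => ⟨?_, fun h => by_contra fun hx => h (hsep ω hω x hx)⟩
    rintro hx ⟨W, -, hxW, hωW⟩
    exact Set.disjoint_left.1 hωW hx hxW
  rw [hcompl]
  exact (measurable_snd (measurableSet_locallyFinite hS)).diff <| .biUnion h𝒲 fun W hW =>
    (hmeas W hW).prod (measurableSet_avoiding (hmeas W hW))

end CountableConfig

theorem IsThinning.ae_points_subset_of_ae_mem_locallyFinite {X : Type*} [MeasurableSpace X]
    [MeasurableSpace.CountablySeparated X] {P : Measure (CountableConfig X)}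
    {Ψ : CountableConfig X → CountableConfig X} (hΨ : IsThinning P Ψ) {S : ℕ → Set X}
    (hS : ∀ k, MeasurableSet (S k)) (hcover : ⋃ k, S k = Set.univ)
    (hfin : ∀ᵐ ω ∂P, ω ∈ CountableConfig.locallyFinite S) :
    ∀ᵐ ω ∂P, (Ψ ω).points ⊆ ω.points := by
  obtain ⟨𝒲, h𝒲, hmeas, hsep⟩ := CountableConfig.exists_countable_separating_points hS hcover
  filter_upwards [(ae_ball_iff h𝒲).2 fun W hW => hΨ.count_le W (hmeas W hW), hfin]
    with ω hle hω x hx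
  by_contra hxω
  obtain ⟨W, hW, hxW, hωW⟩ := hsep ω hω x hxω
  have hvoid : Ψ ω ∈ CountableConfig.avoiding W := by
    rw [← CountableConfig.count_preimage_zero] at hωW ⊢
    exact nonpos_iff_eq_zero.1 ((hle W hW).trans_eq hωW)
  exact Set.disjoint_left.1 hvoid hx hxW

namespace IsPoissonProcess

open CountableConfig

variable {X : Type*} [MeasurableSpace X] {μ : Measure X} {P : Measure (CountableConfig X)}
  {A B : Set X}

theorem map_count (hP : IsPoissonProcess μ P) (hA : MeasurableSet A) (hμA : μ A ≠ ⊤) :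
    P.map (count A) = (poissonMeasure (μ A).toNNReal).map (↑) := by
  have := hP.isProbabilityMeasure
  have := Measure.isProbabilityMeasure_map (μ := P) (measurable_count hA).aemeasurable
  have hcast : MeasurableEmbedding ((↑) : ℕ → ℕ∞) :=
    ⟨Nat.cast_injective, .of_discrete, fun _ _ => .of_discrete⟩
  have hlaw : (P.map (count A)).comap (↑) = poissonMeasure (μ A).toNNReal :=
    Measure.ext_of_singleton fun k => by
      rw [hcast.comap_apply, Set.image_singleton,
        Measure.map_apply (measurable_count hA) (measurableSet_singleton _),
        poissonMeasure_singleton]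
      exact hP.law A hA hμA k
  have := Measure.isProbabilityMeasure_map (μ := poissonMeasure (μ A).toNNReal)
    hcast.measurable.aemeasurable
  refine (Measure.eq_of_le_of_isProbabilityMeasure ?_).symm
  rw [← hlaw, hcast.map_comap]
  exact Measure.restrict_le_self

theorem ae_count_ne_top (hP : IsPoissonProcess μ P) (hA : MeasurableSet A) (hμA : μ A ≠ ⊤) :
    ∀ᵐ ω ∂P, count A ω ≠ ⊤ := by
  refine ae_of_ae_map (measurable_count hA).aemeasurable (p := (· ≠ ⊤)) ?_
  rw [hP.map_count hA hμA, ae_map_iff Measurable.of_discrete.aemeasurable .of_discrete]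
  exact ae_of_all _ ENat.natCast_ne_top

theorem ae_mem_locallyFinite [SigmaFinite μ] (hP : IsPoissonProcess μ P) :
    ∀ᵐ ω ∂P, ω ∈ locallyFinite (spanningSets μ) :=
  ae_all_iff.2 fun k =>
    hP.ae_count_ne_top (measurableSet_spanningSets μ k) (measure_spanningSets_lt_top μ k).ne

theorem lintegral_count (hP : IsPoissonProcess μ P) (hA : MeasurableSet A) (hμA : μ A ≠ ⊤) :
    ∫⁻ ω, (count A ω : ℝ≥0∞) ∂P = μ A := by
  rw [← lintegral_map (f := ENat.toENNReal) .of_discrete (measurable_count hA),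
    hP.map_count hA hμA, lintegral_map .of_discrete .of_discrete]
  simp only [ENat.toENNReal_coe]
  rw [lintegral_natCast_poissonMeasure, ENNReal.coe_toNNReal hμA]

theorem indepFun_count (hP : IsPoissonProcess μ P) (hA : MeasurableSet A) (hB : MeasurableSet B)
    (hAB : Disjoint A B) : IndepFun (count A) (count B) P := by
  have hind := hP.indep 2 ![A, B] (by simp [Fin.forall_fin_two, hA, hB]) (by
    simp [Pairwise, Fin.forall_fin_two, hAB, hAB.symm])
  exact hind.indepFun (i := 0) (j := 1) (by decide)

theorem setLIntegral_count_avoiding (hP : IsPoissonProcess μ P) (hA : MeasurableSet A)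
    (hB : MeasurableSet B) (hμB : μ B ≠ ⊤) :
    ∫⁻ ω in avoiding A, count B ω ∂P = μ (B \ A) * P (avoiding A) := by
  have hcount := measurable_toENNReal_count (hB.diff hA)
  have hvoid := measurableSet_avoiding hA
  have hind : IndepFun (fun ω => (count (B \ A) ω : ℝ≥0∞))
      ((avoiding A).indicator (1 : CountableConfig X → ℝ≥0∞)) P := by
    rw [← count_preimage_zero]
    exact (hP.indepFun_count (hB.diff hA) hA Set.disjoint_sdiff_left).comp
      (φ := ENat.toENNReal) (ψ := Set.indicator {0} (1 : ℕ∞ → ℝ≥0∞)) .of_discrete .of_discrete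
  calc ∫⁻ ω in avoiding A, count B ω ∂P
      = ∫⁻ ω in avoiding A, count (B \ A) ω ∂P :=
        setLIntegral_congr_fun hvoid fun ω hω => by
          simp only [count_diff_of_mem_avoiding hω]
    _ = ∫⁻ ω, count (B \ A) ω * (avoiding A).indicator 1 ω ∂P := by
        rw [← lintegral_indicator hvoid]
        exact lintegral_congr fun ω => by by_cases h : ω ∈ avoiding A <;> simp [h]
    _ = (∫⁻ ω, count (B \ A) ω ∂P) * P (avoiding A) := by
        rw [← lintegral_indicator_one hvoid]
        exact lintegral_mul_eq_lintegral_mul_lintegral_of_indepFun hcount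
          (measurable_one.indicator hvoid) hind
    _ = μ (B \ A) * P (avoiding A) := by
        rw [hP.lintegral_count (hB.diff hA)
          (ne_top_of_le_ne_top hμB (measure_mono Set.sdiff_subset))]

/-- Mecke's formula for functions of the configuration alone. On the void event of `A` it says that
the counts of `A` and `B \ A` are independent, since adding a point `x` keeps `A` void iff
`x ∉ A`. -/
theorem map_insertPoint_prod_restrict [MeasurableSpace.CountablySeparated X]
    (hP : IsPoissonProcess μ P) (hB : MeasurableSet B) (hμB : μ B ≠ ⊤) :
    ((μ.restrict B).prod P).map (fun p => insertPoint p.1 p.2) =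
      P.withDensity fun ω => (count B ω : ℝ≥0∞) := by
  have := hP.isProbabilityMeasure
  have : IsFiniteMeasure (μ.restrict B) := isFiniteMeasure_restrict.2 hμB
  refine ext_of_avoiding fun A hA => ?_
  have hpre : (fun p : X × CountableConfig X => insertPoint p.1 p.2) ⁻¹' avoiding A =
      Aᶜ ×ˢ avoiding A := Set.ext fun _ => insertPoint_mem_avoiding
  rw [Measure.map_apply measurable_insertPoint (measurableSet_avoiding hA), hpre,
    Measure.prod_prod, Measure.restrict_apply hA.compl, Set.inter_comm, ← Set.sdiff_eq,
    withDensity_apply _ (measurableSet_avoiding hA), hP.setLIntegral_count_avoiding hA hB hμB]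

theorem quasiMeasurePreserving_insertPoint [MeasurableSpace.CountablySeparated X] [SigmaFinite μ]
    (hP : IsPoissonProcess μ P) :
    Measure.QuasiMeasurePreserving (fun p => insertPoint p.1 p.2) (μ.prod P) P := by
  have := hP.isProbabilityMeasure
  refine ⟨measurable_insertPoint, .mk fun N hN hPN => ?_⟩
  have hpiece : ∀ k, ∀ᵐ p ∂(μ.prod P).restrict (spanningSets μ k ×ˢ Set.univ),
      insertPoint p.1 p.2 ∉ N := fun k => by
    refine ae_of_ae_map measurable_insertPoint.aemeasurable (p := (· ∉ N)) ?_
    rw [← Measure.restrict_prod_eq_prod_univ, hP.map_insertPoint_prod_restrict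
      (measurableSet_spanningSets μ k) (measure_spanningSets_lt_top μ k).ne]
    exact (withDensity_absolutelyContinuous P _).ae_le (measure_eq_zero_iff_ae_notMem.1 hPN)
  rw [Measure.map_apply measurable_insertPoint hN, ← Measure.restrict_univ (μ := μ.prod P),
    ← Set.univ_prod_univ, ← iUnion_spanningSets μ, Set.iUnion_prod_const]
  exact measure_eq_zero_iff_ae_notMem.2 (ae_restrict_iUnion_iff _ _ |>.2 hpiece)

end IsPoissonProcess

namespace CountableConfig

variable {X : Type*} [MeasurableSpace X] [MeasurableSingletonClass X] {B : Set X}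

theorem uniformOn_points_inter_apply (ω : CountableConfig X) (B C : Set X) :
    uniformOn (ω.points ∩ B) C = (count B ω : ℝ≥0∞)⁻¹ * count (C ∩ B) ω := by
  have hmeas : ∀ A, MeasurableSet (ω.points ∩ A) := fun A =>
    (ω.2.mono Set.inter_subset_left).measurableSet
  rw [uniformOn, cond_apply (hmeas B), Set.inter_assoc, Set.inter_comm B,
    Measure.count_apply (hmeas _), Measure.count_apply (hmeas _)]
  rfl

theorem count_mul_uniformOn_points_inter {ω : CountableConfig X} (hω : count B ω ≠ ⊤) (C : Set X) :
    (count B ω : ℝ≥0∞) * uniformOn (ω.points ∩ B) C = count (C ∩ B) ω := by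
  rw [uniformOn_points_inter_apply]
  by_cases h0 : count B ω = 0
  · have hle : count (C ∩ B) ω ≤ count B ω :=
      Set.encard_le_encard (Set.inter_subset_inter_right _ Set.inter_subset_right)
    simp [nonpos_iff_eq_zero.1 (hle.trans_eq h0)]
  · exact ENNReal.mul_inv_cancel_left (by simpa using h0) (by simpa using hω)

/-- The choice of a point of a configuration uniformly among its points in `B`. As for `uniformOn`,
the measure is zero if the configuration has no points or infinitely many points in `B`. -/
noncomputable def uniformKernel (hB : MeasurableSet B) : Kernel (CountableConfig X) X where
  toFun ω := uniformOn (ω.points ∩ B)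
  measurable' := Measure.measurable_of_measurable_coe _ fun C hC => by
    simp only [uniformOn_points_inter_apply]
    exact (measurable_toENNReal_count hB).inv.mul (measurable_toENNReal_count (hC.inter hB))

instance (hB : MeasurableSet B) : IsFiniteKernel (uniformKernel hB) :=
  ⟨1, ENNReal.one_lt_top, fun ω =>
    prob_le_one (μ := uniformOn (ω.points ∩ B)) (s := Set.univ)⟩

end CountableConfig

namespace IsPoissonProcess

open CountableConfig

variable {X : Type*} [MeasurableSpace X] [MeasurableSpace.CountablySeparated X] {μ : Measure X}
  {P : Measure (CountableConfig X)}

/-- Mecke's formula. The total mass `count B ω` of the counting measure on `ω ∩ B` is moved to the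
law of the configuration, so that only finite kernels occur. -/
theorem map_prodMk_insertPoint_prod_restrict [MeasurableSingletonClass X]
    (hP : IsPoissonProcess μ P) {B : Set X} (hB : MeasurableSet B) (hμB : μ B ≠ ⊤) :
    ((μ.restrict B).prod P).map (fun p => (p.1, insertPoint p.1 p.2)) =
      ((P.withDensity fun ω => (count B ω : ℝ≥0∞)) ⊗ₘ uniformKernel hB).map Prod.swap := by
  have := hP.isProbabilityMeasure
  have : IsFiniteMeasure (μ.restrict B) := isFiniteMeasure_restrict.2 hμB
  refine Measure.ext_prod fun {C E} hC hE => ?_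
  have hpre : (fun p : X × CountableConfig X => (p.1, insertPoint p.1 p.2)) ⁻¹' C ×ˢ E =
      (fun p => insertPoint p.1 p.2) ⁻¹' E ∩ C ×ˢ Set.univ := by
    ext p
    simp [and_comm]
  have hCB : μ (C ∩ B) ≠ ⊤ := ne_top_of_le_ne_top hμB (measure_mono Set.inter_subset_right)
  calc ((μ.restrict B).prod P).map (fun p => (p.1, insertPoint p.1 p.2)) (C ×ˢ E)
      = ((μ.restrict (C ∩ B)).prod P).map (fun p => insertPoint p.1 p.2) E := by
        rw [Measure.map_apply (measurable_fst.prodMk measurable_insertPoint) (hC.prod hE), hpre,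
          Measure.map_apply measurable_insertPoint hE,
          ← Measure.restrict_apply (measurable_insertPoint hE),
          ← Measure.restrict_prod_eq_prod_univ, Measure.restrict_restrict hC]
    _ = ∫⁻ ω in E, count (C ∩ B) ω ∂P := by
        rw [hP.map_insertPoint_prod_restrict (hC.inter hB) hCB, withDensity_apply _ hE]
    _ = ∫⁻ ω in E, count B ω * uniformKernel hB ω C ∂P := by
        refine lintegral_congr_ae (ae_restrict_of_ae ?_)
        filter_upwards [hP.ae_count_ne_top hB hμB] with ω hω
        exact (count_mul_uniformOn_points_inter hω C).symm
    _ = ((P.withDensity fun ω => (count B ω : ℝ≥0∞)) ⊗ₘ uniformKernel hB).map Prod.swap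
          (C ×ˢ E) := by
        rw [Measure.map_apply measurable_swap (hC.prod hE), Set.preimage_swap_prod,
          Measure.compProd_apply_prod hE hC, setLIntegral_withDensity_eq_setLIntegral_mul _
            (measurable_toENNReal_count hB) ((uniformKernel hB).measurable_coe hC) hE]
        rfl

theorem ae_forall_mem_points_inter {B : Set X} (hP : IsPoissonProcess μ P) (hB : MeasurableSet B)
    (hμB : μ B ≠ ⊤) {Z : Set (X × CountableConfig X)} (hZ : MeasurableSet Z)
    (h : ∀ᵐ p ∂(μ.restrict B).prod P, (p.1, insertPoint p.1 p.2) ∈ Z) :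
    ∀ᵐ ω ∂P, ∀ x ∈ ω.points ∩ B, (x, ω) ∈ Z := by
  have := hP.isProbabilityMeasure
  have := MeasurableSpace.measurableSingletonClass_of_countablySeparated (α := X)
  have hchoice : ∀ᵐ q ∂(P.withDensity fun ω => (count B ω : ℝ≥0∞)) ⊗ₘ uniformKernel hB,
      q.swap ∈ Z := by
    refine ae_of_ae_map measurable_swap.aemeasurable (p := (· ∈ Z)) ?_
    rw [← hP.map_prodMk_insertPoint_prod_restrict hB hμB]
    exact (ae_map_iff (measurable_fst.prodMk measurable_insertPoint).aemeasurable hZ).2 h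
  filter_upwards [(ae_withDensity_iff (measurable_toENNReal_count hB)).1
    (Measure.ae_ae_of_ae_compProd hchoice), hP.ae_count_ne_top hB hμB] with ω hω hfin x hx
  have hcount : (count B ω : ℝ≥0∞) ≠ 0 := by
    simpa [count] using Set.nonempty_iff_ne_empty.1 ⟨x, hx⟩
  have hnull := (uniformOn_eq_zero_iff (Set.encard_ne_top_iff.1 hfin)).1 (hω hcount)
  by_contra hxZ
  exact Set.notMem_empty x (hnull ▸ ⟨hx, hxZ⟩)

theorem ae_forall_mem_points [SigmaFinite μ] (hP : IsPoissonProcess μ P)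
    {Z : Set (X × CountableConfig X)} (hZ : MeasurableSet Z)
    (h : ∀ᵐ p ∂μ.prod P, (p.1, insertPoint p.1 p.2) ∈ Z) :
    ∀ᵐ ω ∂P, ∀ x ∈ ω.points, (x, ω) ∈ Z := by
  have := hP.isProbabilityMeasure
  have hk : ∀ k, ∀ᵐ ω ∂P, ∀ x ∈ ω.points ∩ spanningSets μ k, (x, ω) ∈ Z := fun k => by
    refine hP.ae_forall_mem_points_inter (measurableSet_spanningSets μ k)
      (measure_spanningSets_lt_top μ k).ne hZ ?_
    rw [Measure.restrict_prod_eq_prod_univ]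
    exact ae_restrict_of_ae h
  filter_upwards [ae_all_iff.2 hk] with ω hω x hx
  obtain ⟨k, hxk⟩ := Set.iUnion_eq_univ_iff.1 (iUnion_spanningSets μ) x
  exact hω k x ⟨hx, hxk⟩

end IsPoissonProcess

section Thinning

open CountableConfig

variable {X : Type*} [MeasurableSpace X] [MeasurableSpace.CountablySeparated X]
  {μ : Measure X} [SigmaFinite μ] {P : Measure (CountableConfig X)}
  {Ψ : CountableConfig X → CountableConfig X}

theorem IsThinning.ae_points_subset (hP : IsPoissonProcess μ P) (hΨ : IsThinning P Ψ) :
    ∀ᵐ ω ∂P, (Ψ ω).points ⊆ ω.points :=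
  hΨ.ae_points_subset_of_ae_mem_locallyFinite (measurableSet_spanningSets μ)
    (iUnion_spanningSets μ) hP.ae_mem_locallyFinite

theorem IsThinning.ae_apply_mem_locallyFinite (hP : IsPoissonProcess μ P) (hΨ : IsThinning P Ψ) :
    ∀ᵐ ω ∂P, Ψ ω ∈ locallyFinite (spanningSets μ) := by
  filter_upwards [hP.ae_mem_locallyFinite, hΨ.ae_points_subset hP] with ω hω hsub
  exact locallyFinite_of_points_subset hsub hω

theorem IsThinning.measurableSet_setOf_mem_points_apply (hΨ : IsThinning P Ψ) :
    MeasurableSet {p : X × CountableConfig X |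
      p.1 ∈ (Ψ p.2).points ∧ Ψ p.2 ∈ locallyFinite (spanningSets μ)} :=
  (measurable_fst.prodMk (hΨ.measurable.comp measurable_snd)) <|
    measurableSet_setOf_mem_points (measurableSet_spanningSets μ) (iUnion_spanningSets μ)

/-- The pairs `(x, ω)` such that `Ψ` retains the point `x` once it has been added to `ω`. -/
def retainedInsertions (Ψ : CountableConfig X → CountableConfig X) :
    Set (X × CountableConfig X) :=
  {p | p.1 ∈ (Ψ (insertPoint p.1 p.2)).points}

theorem IsThinning.nullMeasurableSet_retainedInsertions (hP : IsPoissonProcess μ P)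
    (hΨ : IsThinning P Ψ) : NullMeasurableSet (retainedInsertions Ψ) (μ.prod P) := by
  refine ⟨_, (measurable_fst.prodMk measurable_insertPoint)
    (hΨ.measurableSet_setOf_mem_points_apply (μ := μ)), ?_⟩
  filter_upwards [hP.quasiMeasurePreserving_insertPoint.ae (hΨ.ae_apply_mem_locallyFinite hP)]
    with p hp
  exact propext (and_iff_left hp).symm

theorem IsThinning.ae_eq_self_of_ae_mem_retainedInsertions (hP : IsPoissonProcess μ P)
    (hΨ : IsThinning P Ψ) (h : ∀ᵐ p ∂μ.prod P, p ∈ retainedInsertions Ψ) :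
    ∀ᵐ ω ∂P, Ψ ω = ω := by
  have hretained : ∀ᵐ ω ∂P, ∀ x ∈ ω.points,
      x ∈ (Ψ ω).points ∧ Ψ ω ∈ locallyFinite (spanningSets μ) :=
    hP.ae_forall_mem_points (hΨ.measurableSet_setOf_mem_points_apply (μ := μ)) <| by
      filter_upwards [h, hP.quasiMeasurePreserving_insertPoint.ae
        (hΨ.ae_apply_mem_locallyFinite hP)] with p hp hfin using ⟨hp, hfin⟩
  filter_upwards [hretained, hΨ.ae_points_subset hP] with ω hω hsub
  exact ext_points (hsub.antisymm fun x hx => (hω x hx).1)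

theorem IsThinning.ae_eq_empty_of_ae_notMem_retainedInsertions (hP : IsPoissonProcess μ P)
    (hΨ : IsThinning P Ψ) (h : ∀ᵐ p ∂μ.prod P, p ∉ retainedInsertions Ψ) :
    ∀ᵐ ω ∂P, Ψ ω = CountableConfig.empty := by
  have hdeleted : ∀ᵐ ω ∂P, ∀ x ∈ ω.points,
      ¬(x ∈ (Ψ ω).points ∧ Ψ ω ∈ locallyFinite (spanningSets μ)) :=
    hP.ae_forall_mem_points (hΨ.measurableSet_setOf_mem_points_apply (μ := μ)).compl <| by
      filter_upwards [h] with p hp using fun hmem => hp hmem.1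
  filter_upwards [hdeleted, hΨ.ae_apply_mem_locallyFinite hP, hΨ.ae_points_subset hP]
    with ω hω hfin hsub
  exact ext_points (Set.eq_empty_of_forall_notMem fun x hx => hω x (hsub hx) ⟨hx, hfin⟩)

theorem IsEquivariantThinning.preimage_smul_retainedInsertions {G : Type*} [Group G]
    [MulAction G X] (hP : IsPoissonProcess μ P) (hΨ : IsEquivariantThinning G P Ψ) (g : G) :
    (g • ·) ⁻¹' retainedInsertions Ψ =ᵐ[μ.prod P] retainedInsertions Ψ := by
  filter_upwards [hP.quasiMeasurePreserving_insertPoint.ae (hΨ.2 g)] with p hp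
  refine propext ?_
  change g • p.1 ∈ (Ψ (insertPoint (g • p.1) (g • p.2))).points ↔
    p.1 ∈ (Ψ (insertPoint p.1 p.2)).points
  rw [← smul_insertPoint, hp, smul_mem_points_smul]

end Thinning

theorem mainTheorem4_general {X G : Type*} [MeasurableSpace X]
    [MeasurableSpace.CountablySeparated X] (μ : Measure X) [SigmaFinite μ]
    [Group G] [MulAction G X] (P : Measure (CountableConfig X)) (hP : IsPoissonProcess μ P)
    (hErg : ErgodicSMul G (X × CountableConfig X) (μ.prod P))
    (Ψ : CountableConfig X → CountableConfig X) (hΨ : IsEquivariantThinning G P Ψ) :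
    IsTrivialThinning P Ψ := by
  have hconst : EventuallyConst (retainedInsertions Ψ) (ae (μ.prod P)) :=
    aeconst_of_forall_preimage_smul_ae_eq G (hΨ.1.nullMeasurableSet_retainedInsertions hP)
      fun g => hΨ.preimage_smul_retainedInsertions hP g
  rcases eventuallyConst_set.1 hconst with hmem | hnotMem
  · exact .inr (hΨ.1.ae_eq_self_of_ae_mem_retainedInsertions hP hmem)
  · exact .inl (hΨ.1.ae_eq_empty_of_ae_notMem_retainedInsertions hP hnotMem)

theorem mainTheorem4 {X G : Type*} [MeasurableSpace X] [StandardBorelSpace X]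
    (μ : Measure X) [SigmaFinite μ] [NullSingletonClass μ]
    [Group G] [MulAction G X] [MeasurableConstSMul G X] [SMulInvariantMeasure G X μ]
    (P : Measure (CountableConfig X)) (hP : IsPoissonProcess μ P)
    (hErg : ErgodicSMul G (X × CountableConfig X) (μ.prod P))
    (Ψ : CountableConfig X → CountableConfig X) (hΨ : IsEquivariantThinning G P Ψ) :
    IsTrivialThinning P Ψ :=
  mainTheorem4_general μ P hP hErg Ψ hΨ
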